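/- Conventions. Let $X$ be a locally compact Hausdorff space. A measure on $X$ is a complex Radon measure: a linear functional $\mu$ on $C_c(X)$ such that for every compact $K\subseteq X$ there is a constant $C_K$ with $|\mu(\varphi)|\le C_K\|\varphi\|_\infty$ for all $\varphi\in C_c(X)$ supported in $K$. Its total variation $|\mu|$ is the positive regular Borel measure with $|\mu|(\varphi)=\sup\{|\mu(\psi)|:\psi\in C_c(X),\ |\psi|\le\varphi\}$ for $0\le\varphi\in C_c(X)$; for $g\in L^1(|\mu|)$, $\mu(g)$ denotes the value at $g$ of the continuous extension of $\mu$ to $L^1(|\mu|)$. For a locally compact abelian (Hausdorff) group $G$ and $t\in G$ let $(T^t\mu)(\varphi)=\mu(\varphi(\cdot+t))$. For a pre-compact set $A\subseteq G$ with non-empty interior let $\|\mu\|_A=\sup_{x\in G}|\mu|(x+A)$ (outer measure if $A$ is not measurable). The measure $\mu$ is norm almost periodic if $\|\mu\|_A<\infty$ and, for each $\varepsilon>0$, the set $P_\varepsilon^A(\mu)=\{t\in G:\|T^t\mu-\mu\|_A<\varepsilon\}$ is relatively dense, i.e. $P_\varepsilon^A(\mu)+K=G$ for some compact $K\subseteq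 G$. Let $d\ge 0$ be an integer, let $G$ be a $\sigma$-compact locally compact abelian group, $H_0$ a locally compact abelian group, and $H=\mathbb{R}^d\times H_0$. Let $(G,H,\mathcal{L})$ be a cut and project scheme, that is, $\mathcal{L}$ is a discrete cocompact subgroup of $G\times H$ whose projection to $H$ is dense and on which the projection to $G$ is one-to-one. Let $\rho$ be an $\mathcal{L}$-periodic measure on $G\times H$, that is, $T^\ell\rho=\rho$ for all $\ell\in\mathcal{L}$. Let $h:H\to\mathbb{C}$ be strongly admissible, that is, $h(x,y)=f(x)\varphi(y)$ for some bounded uniformly continuous $f:\mathbb{R}^d\to\mathbb{C}$ such that $(1+|x|^{2d})f(x)$ is bounded, and some $\varphi\in C_c(H_0)$. Then for each $\phi\in C_c(G)$ the function $(\phi\otimes h)(x,y)=\phi(x)h(y)$ is $|\rho|$-integrable, and $\rho_h(\phi):=\rho(\phi\otimes h)$ defines a measure $\rho_h$ on $G$. This measure $\rho_h$ is norm almost periodic, with respect to every pre-compact $A\subseteq G$ with non-empty interior. -/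

import Mathlib

open Set Filter Topology MeasureTheory
open scoped NNReal ENNReal CompactlySupported

namespace CutProject

/-! ### Complex Radon measures as functionals on `C_c(X, ℂ)` -/

section Radon

variable {X : Type*} [TopologicalSpace X]

/-- The space of (complex) Radon measures on `X`: linear functionals `μ` on `C_c(X, ℂ)` such that
for each compact `K` there is a constant `C` with `|μ(φ)| ≤ C ‖φ‖_∞` whenever `supp φ ⊆ K`. -/
noncomputable def radonSubmodule (X : Type*) [TopologicalSpace X] : Submodule ℂ (C_c(X, ℂ) →ₗ[ℂ] ℂ) where
  carrier := {μ | ∀ K : Set X, IsCompact K → ∃ C : ℝ, ∀ φ : C_c(X, ℂ),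
    tsupport φ ⊆ K → ‖μ φ‖ ≤ C * ⨆ x, ‖φ x‖}
  zero_mem' := fun _ _ => ⟨0, fun φ _ => by simp⟩
  add_mem' := by
    intro μ ν hμ hν K hK
    obtain ⟨C, hC⟩ := hμ K hK
    obtain ⟨D, hD⟩ := hν K hK
    refine ⟨C + D, fun φ hφ => ?_⟩
    rw [LinearMap.add_apply, add_mul]
    exact (norm_add_le _ _).trans (add_le_add (hC φ hφ) (hD φ hφ))
  smul_mem' := by
    intro c μ hμ K hK
    obtain ⟨C, hC⟩ := hμ K hK
    refine ⟨‖c‖ * C, fun φ hφ => ?_⟩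
    rw [LinearMap.smul_apply, norm_smul, mul_assoc]
    exact mul_le_mul_of_nonneg_left (hC φ hφ) (norm_nonneg c)

/-- Complex Radon measures on `X`. -/
noncomputable abbrev RadonMeasure (X : Type*) [TopologicalSpace X] : Type _ := radonSubmodule X

namespace RadonMeasure

noncomputable instance : CoeFun (RadonMeasure X) (fun _ => C_c(X, ℂ) → ℂ) := ⟨fun μ => μ.1⟩

/-- `|μ|(φ) = sup { |μ(ψ)| : ψ ∈ C_c(X), |ψ| ≤ φ }` for `0 ≤ φ ∈ C_c(X)`. -/
noncomputable def variationFun (μ : RadonMeasure X) (φ : C_c(X, ℝ≥0)) : ℝ≥0 :=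
  ⨆ ψ : {ψ : C_c(X, ℂ) // ∀ x, ‖ψ x‖₊ ≤ φ x}, ‖μ ψ.1‖₊

theorem bddAbove_variation (μ : RadonMeasure X) (φ : C_c(X, ℝ≥0)) :
    BddAbove (range fun ψ : {ψ : C_c(X, ℂ) // ∀ x, ‖ψ x‖₊ ≤ φ x} => ‖μ ψ.1‖₊) := by
  obtain ⟨C, hC⟩ := μ.2 (tsupport φ) φ.hasCompactSupport
  obtain ⟨B, hB⟩ := φ.continuous.bddAbove_range_of_hasCompactSupport φ.hasCompactSupport
  refine ⟨(max C 0 * B).toNNReal, ?_⟩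
  rintro _ ⟨⟨ψ, hψ⟩, rfl⟩
  have hsub : tsupport ψ ⊆ tsupport φ := by
    refine closure_mono fun x hx => ?_
    intro h0
    have h1 := hψ x
    rw [h0] at h1
    exact hx (by simpa using h1)
  have h2 : (⨆ x, ‖ψ x‖) ≤ B := by
    refine Real.iSup_le (fun x => ?_) B.2
    exact_mod_cast (hψ x).trans (hB ⟨x, rfl⟩)
  have h3 : (0 : ℝ) ≤ ⨆ x, ‖ψ x‖ := Real.iSup_nonneg fun x => norm_nonneg _
  rw [← NNReal.coe_le_coe, Real.coe_toNNReal _ (by positivity)]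
  calc ‖μ ψ‖ ≤ C * ⨆ x, ‖ψ x‖ := hC ψ hsub
    _ ≤ max C 0 * ⨆ x, ‖ψ x‖ := mul_le_mul_of_nonneg_right (le_max_left _ _) h3
    _ ≤ max C 0 * B := mul_le_mul_of_nonneg_left h2 (le_max_right _ _)

theorem nnnorm_le_variationFun (μ : RadonMeasure X) {φ : C_c(X, ℝ≥0)} {ψ : C_c(X, ℂ)}
    (h : ∀ x, ‖ψ x‖₊ ≤ φ x) : ‖μ ψ‖₊ ≤ μ.variationFun φ :=
  le_ciSup (μ.bddAbove_variation φ) ⟨ψ, h⟩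

theorem variationFun_le (μ : RadonMeasure X) {φ : C_c(X, ℝ≥0)} {c : ℝ≥0}
    (h : ∀ ψ : C_c(X, ℂ), (∀ x, ‖ψ x‖₊ ≤ φ x) → ‖μ ψ‖₊ ≤ c) : μ.variationFun φ ≤ c := by
  have : Nonempty {ψ : C_c(X, ℂ) // ∀ x, ‖ψ x‖₊ ≤ φ x} := ⟨⟨0, fun x => by simp⟩⟩
  exact ciSup_le fun ψ => h ψ.1 ψ.2

theorem exists_split (ψ : C_c(X, ℂ)) (φ₁ φ₂ : C_c(X, ℝ≥0)) (h : ∀ x, ‖ψ x‖₊ ≤ (φ₁ + φ₂) x) :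
    ∃ ψ₁ ψ₂ : C_c(X, ℂ), ψ₁ + ψ₂ = ψ ∧ (∀ x, ‖ψ₁ x‖₊ ≤ φ₁ x) ∧ (∀ x, ‖ψ₂ x‖₊ ≤ φ₂ x) := by
  have key : ∀ φ : C_c(X, ℝ≥0), φ ≤ φ₁ + φ₂ →
      ∃ ψ' : C_c(X, ℂ), ∀ x, ψ' x = ((φ x / (φ₁ + φ₂) x : ℝ≥0) : ℂ) * ψ x := by
    intro φ hφ
    have hle : ∀ x, ‖((φ x / (φ₁ + φ₂) x : ℝ≥0) : ℂ) * ψ x‖ ≤ ‖ψ x‖ := by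
      intro x
      rw [norm_mul]
      refine mul_le_of_le_one_left (norm_nonneg _) ?_
      have : ‖((φ x / (φ₁ + φ₂) x : ℝ≥0) : ℂ)‖ = ((φ x / (φ₁ + φ₂) x : ℝ≥0) : ℝ) :=
        Complex.norm_of_nonneg (NNReal.coe_nonneg _)
      rw [this]
      exact_mod_cast div_le_one_of_le₀ (hφ x) (zero_le)
    refine ⟨⟨⟨fun x => ((φ x / (φ₁ + φ₂) x : ℝ≥0) : ℂ) * ψ x, ?_⟩, ?_⟩, fun x => rfl⟩
    · rw [continuous_iff_continuousAt]
      intro x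
      by_cases hx : (φ₁ + φ₂) x = 0
      · have h0 : ψ x = 0 := by
          have := h x
          rw [hx] at this
          simpa using this
        have hlim : Tendsto (fun y => ‖ψ y‖) (𝓝 x) (𝓝 0) := by
          have := (ψ.continuous.norm).tendsto x
          simpa [h0] using this
        have := squeeze_zero_norm hle hlim
        simpa [ContinuousAt, h0] using this
      · have h1 : ContinuousAt (fun y => φ y / (φ₁ + φ₂) y) x :=
          φ.continuous.continuousAt.div₀ (φ₁ + φ₂).continuous.continuousAt hx
        have h2 : Continuous (fun r : ℝ≥0 => ((r : ℝ) : ℂ)) :=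
          Complex.continuous_ofReal.comp NNReal.continuous_coe
        exact (h2.continuousAt.comp h1).mul ψ.continuous.continuousAt
    · exact ψ.hasCompactSupport.mul_left
  obtain ⟨ψ₁, h₁⟩ := key φ₁ (fun x => by simp)
  obtain ⟨ψ₂, h₂⟩ := key φ₂ (fun x => by simp)
  have hb : ∀ (φ : C_c(X, ℝ≥0)) (ψ' : C_c(X, ℂ)), 
      (∀ x, ψ' x = ((φ x / (φ₁ + φ₂) x : ℝ≥0) : ℂ) * ψ x) → ∀ x, ‖ψ' x‖₊ ≤ φ x := by
    intro φ ψ' h' x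
    rw [h' x, nnnorm_mul]
    have : ‖((φ x / (φ₁ + φ₂) x : ℝ≥0) : ℂ)‖₊ = φ x / (φ₁ + φ₂) x := by
      ext
      exact Complex.norm_of_nonneg (NNReal.coe_nonneg _)
    rw [this]
    by_cases hx : (φ₁ + φ₂) x = 0
    · simp [hx]
    · calc φ x / (φ₁ + φ₂) x * ‖ψ x‖₊ ≤ φ x / (φ₁ + φ₂) x * (φ₁ + φ₂) x :=
            mul_le_mul_right (h x) _
        _ = φ x := div_mul_cancel₀ _ hx
  refine ⟨ψ₁, ψ₂, ?_, hb φ₁ ψ₁ h₁, hb φ₂ ψ₂ h₂⟩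
  ext x
  rw [CompactlySupportedContinuousMap.add_apply, h₁, h₂, ← add_mul]
  by_cases hx : (φ₁ + φ₂) x = 0
  · have h0 : ψ x = 0 := by
      have := h x
      rw [hx] at this
      simpa using this
    simp [h0]
  · have : φ₁ x / (φ₁ + φ₂) x + φ₂ x / (φ₁ + φ₂) x = 1 := by
      rw [← add_div]
      exact div_self hx
    have h3 : ((φ₁ x / (φ₁ + φ₂) x : ℝ≥0) : ℂ) + ((φ₂ x / (φ₁ + φ₂) x : ℝ≥0) : ℂ) = 1 := by
      exact_mod_cast congrArg (fun r : ℝ≥0 => ((r : ℝ) : ℂ)) this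
    rw [h3, one_mul]

theorem exists_phase (μ : RadonMeasure X) (ψ : C_c(X, ℂ)) :
    ∃ ψ' : C_c(X, ℂ), (∀ x, ‖ψ' x‖₊ ≤ ‖ψ x‖₊) ∧ μ ψ' = (‖μ ψ‖ : ℂ) := by
  by_cases h : μ ψ = 0
  · exact ⟨0, fun x => by simp, by simp [h]⟩
  · have hn : (‖μ ψ‖ : ℂ) ≠ 0 := by simpa using h
    refine ⟨((‖μ ψ‖ : ℂ) / μ ψ) • ψ, fun x => ?_, ?_⟩
    · rw [CompactlySupportedContinuousMap.smul_apply, smul_eq_mul, nnnorm_mul]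
      have : ‖(‖μ ψ‖ : ℂ) / μ ψ‖₊ = 1 := by
        rw [nnnorm_div]
        simp [h]
      rw [this, one_mul]
    · rw [map_smul, smul_eq_mul, div_mul_cancel₀ _ h]

theorem variationFun_add (μ : RadonMeasure X) (φ₁ φ₂ : C_c(X, ℝ≥0)) :
    μ.variationFun (φ₁ + φ₂) = μ.variationFun φ₁ + μ.variationFun φ₂ := by
  apply le_antisymm
  · refine μ.variationFun_le fun ψ hψ => ?_
    obtain ⟨ψ₁, ψ₂, rfl, h₁, h₂⟩ := exists_split ψ φ₁ φ₂ hψ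
    rw [map_add]
    exact (nnnorm_add_le _ _).trans
      (add_le_add (μ.nnnorm_le_variationFun h₁) (μ.nnnorm_le_variationFun h₂))
  · have hsum : ∀ ψ₁ ψ₂ : C_c(X, ℂ), (∀ x, ‖ψ₁ x‖₊ ≤ φ₁ x) → (∀ x, ‖ψ₂ x‖₊ ≤ φ₂ x) →
        ‖μ ψ₁‖₊ + ‖μ ψ₂‖₊ ≤ μ.variationFun (φ₁ + φ₂) := ?_
    · have h2 : μ.variationFun φ₂ ≤ μ.variationFun (φ₁ + φ₂) := μ.variationFun_le fun ψ₂ h₂ => by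
        simpa using hsum 0 ψ₂ (fun x => by simp) h₂
      refine add_le_of_le_tsub_right_of_le h2 (μ.variationFun_le fun ψ₁ h₁ => ?_)
      have h1 : ‖μ ψ₁‖₊ ≤ μ.variationFun (φ₁ + φ₂) := by
        simpa using hsum ψ₁ 0 h₁ (fun x => by simp)
      refine le_tsub_of_add_le_right (add_le_of_le_tsub_left_of_le h1 ?_)
      exact μ.variationFun_le fun ψ₂ h₂ => le_tsub_of_add_le_left (hsum ψ₁ ψ₂ h₁ h₂)
    intro ψ₁ ψ₂ hψ₁ hψ₂
    obtain ⟨θ₁, h₁, e₁⟩ := μ.exists_phase ψ₁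
    obtain ⟨θ₂, h₂, e₂⟩ := μ.exists_phase ψ₂
    have hθ : ∀ x, ‖(θ₁ + θ₂) x‖₊ ≤ (φ₁ + φ₂) x := fun x =>
      (nnnorm_add_le _ _).trans
        (add_le_add ((h₁ x).trans (hψ₁ x)) ((h₂ x).trans (hψ₂ x)))
    have := μ.nnnorm_le_variationFun hθ
    rw [map_add, e₁, e₂] at this
    convert this using 1
    ext
    rw [← Complex.ofReal_add]
    simp only [NNReal.coe_add, coe_nnnorm, Complex.norm_real, Real.norm_eq_abs]
    rw [abs_of_nonneg (by positivity)]

theorem variationFun_smul (μ : RadonMeasure X) (r : ℝ≥0) (φ : C_c(X, ℝ≥0)) :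
    μ.variationFun (r • φ) = r • μ.variationFun φ := by
  have main : ∀ (s : ℝ≥0) (θ : C_c(X, ℝ≥0)), s ≠ 0 →
      μ.variationFun (s • θ) ≤ s • μ.variationFun θ := by
    intro s θ hs
    refine μ.variationFun_le fun ψ hψ => ?_
    have hsc : (s : ℂ) ≠ 0 := by exact_mod_cast hs
    have hsn : ‖((s : ℝ) : ℂ)‖₊ = s := by ext; simp
    have h1 : ∀ x, ‖((((s : ℝ) : ℂ)⁻¹ • ψ : C_c(X, ℂ)) x)‖₊ ≤ θ x := by
      intro x
      rw [CompactlySupportedContinuousMap.smul_apply, smul_eq_mul, nnnorm_mul, nnnorm_inv, hsn]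
      calc s⁻¹ * ‖ψ x‖₊ ≤ s⁻¹ * (s * θ x) := mul_le_mul_right (hψ x) _
        _ = θ x := inv_mul_cancel_left₀ hs _
    have h2 := μ.nnnorm_le_variationFun h1
    rw [map_smul, smul_eq_mul, nnnorm_mul, nnnorm_inv, hsn] at h2
    calc ‖μ ψ‖₊ = s * (s⁻¹ * ‖μ ψ‖₊) := (mul_inv_cancel_left₀ hs _).symm
      _ ≤ s * μ.variationFun θ := mul_le_mul_right h2 _
  by_cases hr : r = 0
  · subst hr
    rw [zero_smul, zero_smul]
    refine le_antisymm (μ.variationFun_le fun ψ hψ => ?_) (zero_le)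
    have : ψ = 0 := by
      ext x
      simpa using hψ x
    simp [this]
  · apply le_antisymm (main r φ hr)
    have h := main r⁻¹ (r • φ) (inv_ne_zero hr)
    rw [smul_smul, inv_mul_cancel₀ hr, one_smul] at h
    calc r • μ.variationFun φ ≤ r • r⁻¹ • μ.variationFun (r • φ) := mul_le_mul_right h _
      _ = μ.variationFun (r • φ) := by rw [smul_smul, mul_inv_cancel₀ hr, one_smul]

/-- The total variation of `μ`, as a positive linear functional. -/
noncomputable def variation (μ : RadonMeasure X) : C_c(X, ℝ≥0) →ₗ[ℝ≥0] ℝ≥0 where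
  toFun := μ.variationFun
  map_add' := μ.variationFun_add
  map_smul' := μ.variationFun_smul

variable [T2Space X] [LocallyCompactSpace X]

/-- The total variation `|μ|` of `μ`, as the regular Borel measure that represents the positive
functional `φ ↦ |μ|(φ)`. It is a measure on the Borel σ-algebra of `X`, which is written out since
on a product space it may be larger than the product σ-algebra. -/
noncomputable def totalVariation (μ : RadonMeasure X) : @Measure X (borel X) :=
  letI : MeasurableSpace X := borel X
  have : BorelSpace X := ⟨rfl⟩
  NNRealRMK.rieszMeasure μ.variation

/-- `μ.HasIntegral g I`: the function `g` is `|μ|`-integrable and `∫ g dμ = I`. Here `∫ g dμ` is the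
value at `g` of the continuous extension of `μ : C_c(X, ℂ) → ℂ` to `L¹(|μ|)`, that is, the limit of
`μ(ψ)` as `ψ ∈ C_c(X, ℂ)` tends to `g` in `L¹(|μ|)`. -/
def HasIntegral (μ : RadonMeasure X) (g : X → ℂ) (I : ℂ) : Prop :=
  Integrable g μ.totalVariation ∧
    Tendsto (fun ψ : C_c(X, ℂ) => μ ψ)
      (comap (fun ψ : C_c(X, ℂ) => ∫⁻ x, ‖g x - ψ x‖ₑ ∂μ.totalVariation) (𝓝 0)) (𝓝 I)

end RadonMeasure

end Radon

/-! ### Translation, periodicity and norm almost periodicity -/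

section Group

variable {G : Type*} [AddCommGroup G] [TopologicalSpace G] [IsTopologicalAddGroup G]

/-- The translate `x ↦ φ (x - t)` of a function `φ ∈ C_c(G, ℂ)`. -/
noncomputable def translateFun (t : G) (φ : C_c(G, ℂ)) : C_c(G, ℂ) :=
  φ.comp (Homeomorph.subRight t).toCocompactMap

theorem translateFun_apply (t : G) (φ : C_c(G, ℂ)) (x : G) : translateFun t φ x = φ (x - t) := rfl

/-- `translateFun t` as a linear map. -/
noncomputable def translateLin (t : G) : C_c(G, ℂ) →ₗ[ℂ] C_c(G, ℂ) where
  toFun := translateFun t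
  map_add' := fun _ _ => by ext x; rfl
  map_smul' := fun _ _ => by ext x; rfl

/-- The translate `T^t μ` of a measure `μ`: `(T^t μ)(φ) = ∫ φ (x + t) dμ(x)`. -/
noncomputable def translate (t : G) (μ : RadonMeasure G) : RadonMeasure G :=
  ⟨μ.1.comp (translateLin (-t)), by
    intro K hK
    obtain ⟨C, hC⟩ := μ.2 ((fun x => x - t) '' K) (hK.image (continuous_id.sub continuous_const))
    refine ⟨C, fun φ hφ => ?_⟩
    have hsub : tsupport (translateFun (-t) φ) ⊆ (fun x => x - t) '' K := by
      intro x hx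
      have h1 : x + t ∈ tsupport φ := by
        have h2 : tsupport (φ ∘ Homeomorph.addRight t) = Homeomorph.addRight t ⁻¹' tsupport φ :=
          tsupport_comp_eq_preimage _ (Homeomorph.addRight t)
        have h3 : (translateFun (-t) φ : G → ℂ) = φ ∘ Homeomorph.addRight t := by
          funext y
          simp [translateFun_apply]
        rw [h3, h2] at hx
        exact hx
      exact ⟨x + t, hφ h1, add_sub_cancel_right x t⟩
    have hsup : (⨆ x, ‖translateFun (-t) φ x‖) = ⨆ x, ‖φ x‖ :=
      (Equiv.subRight (-t)).iSup_comp (g := fun x => ‖φ x‖)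
    have := hC (translateFun (-t) φ) hsub
    rw [hsup] at this
    exact this⟩

theorem translate_apply (t : G) (μ : RadonMeasure G) (φ : C_c(G, ℂ)) :
    translate t μ φ = μ (translateFun (-t) φ) := rfl

/-- `μ` is `L`-periodic if `T^t μ = μ` for all `t ∈ L`. -/
def IsPeriodic (L : AddSubgroup G) (μ : RadonMeasure G) : Prop :=
  ∀ t ∈ L, translate t μ = μ

/-- A subset `P` of `G` is relatively dense if `P + K = G` for some compact `K`. -/
def IsRelativelyDense (P : Set G) : Prop :=
  ∃ K : Set G, IsCompact K ∧ ∀ x : G, ∃ p ∈ P, ∃ k ∈ K, x = p + k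

variable [T2Space G] [LocallyCompactSpace G]

/-- The norm `‖μ‖_A = sup_{x ∈ G} |μ|(x + A)`, with values in `[0, ∞]`. -/
noncomputable def aNorm (A : Set G) (μ : RadonMeasure G) : ℝ≥0∞ :=
  ⨆ x : G, μ.totalVariation ((fun a => x + a) '' A)

/-- `μ` is translation bounded (with respect to the set `A`). -/
def IsTranslationBounded (A : Set G) (μ : RadonMeasure G) : Prop :=
  aNorm A μ < ∞

/-- The set `P_ε^A(μ)` of `ε`-norm almost periods of `μ`. -/
def normAlmostPeriods (A : Set G) (μ : RadonMeasure G) (ε : ℝ) : Set G :=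
  {t | aNorm A (translate t μ - μ) < ENNReal.ofReal ε}

/-- `μ` is norm almost periodic (with respect to the set `A`): it is translation bounded and, for
each `ε > 0`, its set of `ε`-norm almost periods is relatively dense. -/
def IsNormAlmostPeriodic (A : Set G) (μ : RadonMeasure G) : Prop :=
  IsTranslationBounded A μ ∧ ∀ ε : ℝ, 0 < ε → IsRelativelyDense (normAlmostPeriods A μ ε)

end Group

/-! ### Cut and project schemes and strongly admissible functions -/

section CPS

variable {G H : Type*} [AddCommGroup G] [TopologicalSpace G] [IsTopologicalAddGroup G]
  [AddCommGroup H] [TopologicalSpace H] [IsTopologicalAddGroup H]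

/-- `(G, H, L)` is a cut and project scheme, where `G`, `H` are locally compact abelian groups:
`G` is σ-compact, `L` is a lattice (a discrete cocompact subgroup) in `G × H` whose projection to
`H` is dense, and the projection to `G` is one-to-one on `L`. -/
structure IsCutAndProjectScheme (L : AddSubgroup (G × H)) : Prop where
  sigmaCompact : SigmaCompactSpace G
  discrete : DiscreteTopology L
  cocompact : CompactSpace ((G × H) ⧸ L)
  dense_snd : Dense (Prod.snd '' (L : Set (G × H)))
  injOn_fst : InjOn Prod.fst (L : Set (G × H))

/-- A function `h` on `ℝ^d × H₀` is strongly admissible if `h = f ⊗ φ` with `f` bounded and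
uniformly continuous on `ℝ^d`, `(1 + |x|^{2d}) f` bounded, and `φ ∈ C_c(H₀)`. -/
def IsStronglyAdmissible {d : ℕ} {H₀ : Type*} [TopologicalSpace H₀]
    (h : EuclideanSpace ℝ (Fin d) × H₀ → ℂ) : Prop :=
  ∃ (f : EuclideanSpace ℝ (Fin d) → ℂ) (φ : C_c(H₀, ℂ)),
    UniformContinuous f ∧ (∃ C : ℝ, ∀ x, ‖f x‖ ≤ C) ∧
    (∃ C : ℝ, ∀ x, ‖((1 + ‖x‖ ^ (2 * d) : ℝ) : ℂ) * f x‖ ≤ C) ∧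
    ∀ p, h p = f p.1 * φ p.2

variable [T2Space G] [LocallyCompactSpace G] [T2Space H] [LocallyCompactSpace H]

/-- `μ` is the projected measure `ρ_h`, i.e. `μ(φ) = ρ(φ ⊗ h)` for all `φ ∈ C_c(G)`, where
in particular `φ ⊗ h` is integrable with respect to `|ρ|`. -/
def IsProjectedMeasure (ρ : RadonMeasure (G × H)) (h : H → ℂ) (μ : RadonMeasure G) : Prop :=
  ∀ φ : C_c(G, ℂ), ρ.HasIntegral (fun p => φ p.1 * h p.2) (μ φ)

end CPS

end CutProject

/-!
A strongly admissible function `h` lies in the Wiener amalgam space `W(C, ℓ¹)`: it is continuous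
and dominated by `∑ z, a z • 𝟙_{z + Q}` with `Q` compact and `∑ z, a z < ∞`. A periodic measure `ρ`
is translation bounded, `|ρ| (x + K ×ˢ Q) ≤ C`, so `∫ |φ ⊗ h| d|ρ| ≤ C ‖φ‖ ∑ z, a z` whenever `φ`
is supported in a translate of `K`; this gives existence of `ρ_h` and `‖ρ_h‖_A ≤ C ∑ z, a z`.

For `(s, w) ∈ 𝓛`, periodicity identifies `T^s ρ_h - ρ_h` with the projected measure of
`h (· - w) - h`. Because `h` is uniformly continuous, this difference is dominated by weights with
arbitrarily small sum once `w` is close to `0`. Cocompactness of `𝓛` makes the set of all such `s`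
relatively dense.
-/

namespace CutProject

open Function Pointwise

namespace RadonMeasure

section Integral

variable {X : Type*} [TopologicalSpace X] [T2Space X] [LocallyCompactSpace X] {μ : RadonMeasure X}

theorem regular_totalVariation (μ : RadonMeasure X) :
    @Measure.Regular X (borel X) _ μ.totalVariation := by
  borelize X
  exact NNRealRMK.rieszMeasure_regular μ.variation

theorem lintegral_totalVariation (μ : RadonMeasure X) (φ : C_c(X, ℝ≥0)) :
    ∫⁻ x, φ x ∂μ.totalVariation = μ.variationFun φ := by
  borelize X
  exact NNRealRMK.lintegral_rieszMeasure μ.variation φ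

theorem totalVariation_lt_top_of_isCompact (μ : RadonMeasure X) {K : Set X} (hK : IsCompact K) :
    μ.totalVariation K < ∞ := by
  borelize X
  have := μ.regular_totalVariation
  exact hK.measure_lt_top

theorem totalVariation_le_of_forall_enorm_le {B : Set X} {χ : C_c(X, ℝ≥0)} {M : ℝ≥0∞}
    (hB : ∀ x ∈ B, 1 ≤ χ x) (hM : ∀ ψ : C_c(X, ℂ), (∀ x, ‖ψ x‖₊ ≤ χ x) → ‖μ ψ‖ₑ ≤ M) :
    μ.totalVariation B ≤ M := by
  borelize X
  obtain rfl | hM_top := eq_or_ne M ∞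
  · exact le_top
  lift M to ℝ≥0 using hM_top
  calc μ.totalVariation B
      ≤ μ.totalVariation {x | (1 : ℝ≥0∞) ≤ χ x} :=
        measure_mono fun x hx => ENNReal.one_le_coe_iff.2 (hB x hx)
    _ ≤ ∫⁻ x, χ x ∂μ.totalVariation := by
        simpa using mul_meas_ge_le_lintegral χ.continuous.measurable.coe_nnreal_ennreal 1
    _ = μ.variationFun χ := μ.lintegral_totalVariation χ
    _ ≤ M := ENNReal.coe_le_coe.2
        (μ.variationFun_le fun ψ hψ => ENNReal.coe_le_coe.1 (hM ψ hψ))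

theorem enorm_apply_le_lintegral (μ : RadonMeasure X) (ψ : C_c(X, ℂ)) :
    ‖μ ψ‖ₑ ≤ ∫⁻ x, ‖ψ x‖ₑ ∂μ.totalVariation := by
  let absψ : C_c(X, ℝ≥0) :=
    ⟨⟨fun x => ‖ψ x‖₊, ψ.continuous.nnnorm⟩, ψ.hasCompactSupport.comp_left nnnorm_zero⟩
  calc ‖μ ψ‖ₑ ≤ μ.variationFun absψ :=
        ENNReal.coe_le_coe.2 (μ.nnnorm_le_variationFun fun _ => le_rfl)
    _ = ∫⁻ x, ‖ψ x‖ₑ ∂μ.totalVariation := (μ.lintegral_totalVariation absψ).symm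

theorem aestronglyMeasurable_of_continuous (μ : RadonMeasure X) {g : X → ℂ} (hg : Continuous g) :
    AEStronglyMeasurable[borel X] g μ.totalVariation := by
  borelize X
  exact hg.aestronglyMeasurable

/-- The neighbourhoods of `g` in `L¹(|μ|)`, as a filter on `C_c(X, ℂ)`. The value at `g` of the
continuous extension of `μ` to `L¹(|μ|)` is the limit of `μ` along this filter. -/
noncomputable def nhdsL1 (μ : RadonMeasure X) (g : X → ℂ) : Filter C_c(X, ℂ) :=
  comap (fun ψ : C_c(X, ℂ) => ∫⁻ x, ‖g x - ψ x‖ₑ ∂μ.totalVariation) (𝓝 0)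

theorem exists_eLpNorm_sub_indicator_le (μ : RadonMeasure X) (c : ℂ) {B : Set X}
    (hB : MeasurableSet[borel X] B) (hμB : μ.totalVariation B < ∞) {ε : ℝ≥0∞} (hε : ε ≠ 0) :
    ∃ ψ : C_c(X, ℂ), eLpNorm (⇑ψ - B.indicator fun _ => c) 1 μ.totalVariation ≤ ε := by
  borelize X
  have := μ.regular_totalVariation
  obtain ⟨η, hη0, hη⟩ := exists_eLpNorm_indicator_le (μ := μ.totalVariation) ENNReal.one_ne_top c hε
  have hη2 : (η / 2 : ℝ≥0∞) ≠ 0 := (ENNReal.half_pos (ENNReal.coe_ne_zero.2 hη0.ne')).ne'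
  obtain ⟨K, hKB, hK, -, hμK⟩ := hB.exists_isCompact_isClosed_sdiff_lt hμB.ne hη2
  obtain ⟨U, hBU, hU, -, hμU⟩ := hB.exists_isOpen_sdiff_lt hμB.ne hη2
  obtain ⟨χ, hχ1, hχ0, hχsupp, hχI⟩ := exists_continuous_one_zero_of_isCompact hK hU.isClosed_compl
    (disjoint_compl_right_iff_subset.2 (hKB.trans hBU))
  let ψ : C_c(X, ℂ) := ⟨⟨fun x => (χ x : ℂ) * c, by fun_prop⟩,
    HasCompactSupport.mul_right (hχsupp.comp_left Complex.ofReal_zero)⟩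
  have hψ (x : X) : ψ x = (χ x : ℂ) * c := rfl
  have hUK : μ.totalVariation (U \ K) ≤ η :=
    calc μ.totalVariation (U \ K) ≤ μ.totalVariation (U \ B ∪ B \ K) :=
          measure_mono (sdiff_triangle U B K)
      _ ≤ η / 2 + η / 2 := (measure_union_le _ _).trans (add_le_add hμU.le hμK.le)
      _ = η := ENNReal.add_halves _
  refine ⟨ψ, (eLpNorm_mono fun x => ?_).trans (hη (U \ K) hUK)⟩
  rw [Pi.sub_apply, hψ]
  by_cases hxK : x ∈ K
  · simp [hχ1 hxK, hxK, hKB hxK]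
  by_cases hxU : x ∈ U
  swap
  · simp [hχ0 hxU, hxU, mt (@hBU x) hxU]
  rw [indicator_of_mem (show x ∈ U \ K from ⟨hxU, hxK⟩)]
  by_cases hxB : x ∈ B
  · rw [indicator_of_mem hxB, ← sub_one_mul, norm_mul, ← Complex.ofReal_one, ← Complex.ofReal_sub,
      Complex.norm_real, Real.norm_eq_abs]
    exact mul_le_of_le_one_left (norm_nonneg c)
      (abs_le.2 ⟨by linarith [(hχI x).1], by linarith [(hχI x).2]⟩)
  · rw [indicator_of_notMem hxB, sub_zero, norm_mul, Complex.norm_of_nonneg (hχI x).1]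
    exact mul_le_of_le_one_left (norm_nonneg c) (hχI x).2

theorem nhdsL1_neBot {g : X → ℂ} (hg : Integrable g μ.totalVariation) : (μ.nhdsL1 g).NeBot := by
  borelize X
  refine comap_neBot fun t ht => ?_
  obtain ⟨ε, hε, hεt⟩ := ENNReal.nhds_zero_basis_Iic.mem_iff.1 ht
  obtain ⟨_, hψ, ψ, rfl⟩ := (memLp_one_iff_integrable.2 hg).induction_dense ENNReal.one_ne_top
    (· ∈ range fun ψ : C_c(X, ℂ) => ⇑ψ)
    (fun c B hB hμB δ hδ => by
      obtain ⟨ψ, hψ⟩ := μ.exists_eLpNorm_sub_indicator_le c hB hμB hδ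
      exact ⟨ψ, hψ, ψ, rfl⟩)
    (by rintro _ _ ⟨ψ, rfl⟩ ⟨θ, rfl⟩; exact ⟨ψ + θ, rfl⟩)
    (by rintro _ ⟨ψ, rfl⟩; exact μ.aestronglyMeasurable_of_continuous ψ.continuous) hε.ne'
  rw [eLpNorm_one_eq_lintegral_enorm] at hψ
  exact ⟨ψ, hεt hψ⟩

theorem tendsto_lintegral_nhdsL1 (μ : RadonMeasure X) (g : X → ℂ) :
    Tendsto (fun ψ : C_c(X, ℂ) => ∫⁻ x, ‖g x - ψ x‖ₑ ∂μ.totalVariation) (μ.nhdsL1 g) (𝓝 0) :=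
  tendsto_comap

theorem enorm_apply_sub_apply_le {g : X → ℂ}
    (hg : AEStronglyMeasurable[borel X] g μ.totalVariation) (ψ θ : C_c(X, ℂ)) :
    ‖μ ψ - μ θ‖ₑ ≤ ∫⁻ x, ‖g x - ψ x‖ₑ ∂μ.totalVariation +
      ∫⁻ x, ‖g x - θ x‖ₑ ∂μ.totalVariation := by
  have hmeas : AEMeasurable[borel X] (fun x => ‖g x - ψ x‖ₑ) μ.totalVariation :=
    (hg.sub (μ.aestronglyMeasurable_of_continuous ψ.continuous)).enorm
  rw [← map_sub, ← lintegral_add_left' hmeas]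
  refine (μ.enorm_apply_le_lintegral (ψ - θ)).trans (lintegral_mono fun x => ?_)
  calc ‖(ψ - θ) x‖ₑ = ‖(g x - θ x) - (g x - ψ x)‖ₑ := by
        rw [sub_sub_sub_cancel_left, CompactlySupportedContinuousMap.sub_apply]
    _ ≤ ‖g x - ψ x‖ₑ + ‖g x - θ x‖ₑ := enorm_sub_le.trans_eq (add_comm _ _)

theorem exists_hasIntegral {g : X → ℂ} (hg : Integrable g μ.totalVariation) :
    ∃ I, μ.HasIntegral g I := by
  have := nhdsL1_neBot hg
  have hCauchy : Cauchy (map (fun ψ : C_c(X, ℂ) => μ ψ) (μ.nhdsL1 g)) := by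
    refine EMetric.cauchy_iff.2 ⟨(this.map _).ne, fun ε hε => ?_⟩
    refine ⟨_, image_mem_map ((μ.tendsto_lintegral_nhdsL1 g).eventually
      (gt_mem_nhds (ENNReal.half_pos hε.ne'))), ?_⟩
    rintro _ ⟨ψ, hψ, rfl⟩ _ ⟨θ, hθ, rfl⟩
    calc edist (μ ψ) (μ θ) = ‖μ ψ - μ θ‖ₑ := edist_eq_enorm_sub _ _
      _ ≤ _ := enorm_apply_sub_apply_le hg.1 ψ θ
      _ < ε / 2 + ε / 2 := ENNReal.add_lt_add hψ hθ
      _ = ε := ENNReal.add_halves ε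
  obtain ⟨I, hI⟩ := CompleteSpace.complete hCauchy
  exact ⟨I, hg, hI⟩

theorem HasIntegral.unique {g : X → ℂ} {I J : ℂ} (hI : μ.HasIntegral g I)
    (hJ : μ.HasIntegral g J) : I = J :=
  have := nhdsL1_neBot hI.1
  tendsto_nhds_unique (l := μ.nhdsL1 g) hI.2 hJ.2

theorem hasIntegral_of_tendsto {ι : Type*} {l : Filter ι} [l.NeBot] {ψ : ι → C_c(X, ℂ)}
    {g : X → ℂ} {I : ℂ} (hg : Integrable g μ.totalVariation)
    (hψ : Tendsto (fun i => ∫⁻ x, ‖g x - ψ i x‖ₑ ∂μ.totalVariation) l (𝓝 0))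
    (hI : Tendsto (fun i => μ (ψ i)) l (𝓝 I)) : μ.HasIntegral g I := by
  obtain ⟨J, hJ⟩ := exists_hasIntegral hg
  rwa [tendsto_nhds_unique hI (hJ.2.comp (tendsto_comap_iff.2 hψ))]

theorem HasIntegral.enorm_le {g : X → ℂ} {I : ℂ} (h : μ.HasIntegral g I) :
    ‖I‖ₑ ≤ ∫⁻ x, ‖g x‖ₑ ∂μ.totalVariation := by
  have := nhdsL1_neBot h.1
  have hlim : Tendsto (fun ψ : C_c(X, ℂ) => ‖μ ψ‖ₑ) (μ.nhdsL1 g) (𝓝 ‖I‖ₑ) := h.2.enorm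
  have hbound := (μ.tendsto_lintegral_nhdsL1 g).add_const (∫⁻ x, ‖g x‖ₑ ∂μ.totalVariation)
  rw [zero_add] at hbound
  exact le_of_tendsto_of_tendsto' hlim hbound fun ψ => by
    simpa using enorm_apply_sub_apply_le h.1.1 ψ 0

theorem HasIntegral.add {g k : X → ℂ} {I J : ℂ} (hI : μ.HasIntegral g I)
    (hJ : μ.HasIntegral k J) : μ.HasIntegral (g + k) (I + J) := by
  have := nhdsL1_neBot hI.1
  have := nhdsL1_neBot hJ.1
  refine hasIntegral_of_tendsto (l := μ.nhdsL1 g ×ˢ μ.nhdsL1 k) (ψ := fun p => p.1 + p.2)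
    (hI.1.add hJ.1) ?_ ?_
  · have hlim := ((μ.tendsto_lintegral_nhdsL1 g).comp tendsto_fst).add
      ((μ.tendsto_lintegral_nhdsL1 k).comp (tendsto_snd (f := μ.nhdsL1 g)))
    rw [add_zero] at hlim
    refine tendsto_of_tendsto_of_tendsto_of_le_of_le tendsto_const_nhds hlim
      (fun _ => zero_le) fun p => ?_
    refine le_trans (lintegral_mono fun x => ?_) (lintegral_add_left' (hI.1.1.sub
      (μ.aestronglyMeasurable_of_continuous p.1.continuous)).enorm _).le
    calc ‖(g + k) x - (p.1 + p.2) x‖ₑ = ‖(g x - p.1 x) + (k x - p.2 x)‖ₑ := by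
          rw [Pi.add_apply, CompactlySupportedContinuousMap.add_apply, add_sub_add_comm]
      _ ≤ _ := enorm_add_le _ _
  · simp only [map_add]
    exact (hI.2.comp tendsto_fst).add (hJ.2.comp tendsto_snd)

theorem HasIntegral.const_mul {g : X → ℂ} {I : ℂ} (hI : μ.HasIntegral g I) (c : ℂ) :
    μ.HasIntegral (fun x => c * g x) (c * I) := by
  have := nhdsL1_neBot hI.1
  refine hasIntegral_of_tendsto (l := μ.nhdsL1 g) (ψ := fun ψ => c • ψ) (hI.1.const_mul c) ?_ ?_
  · have hlim := ENNReal.Tendsto.const_mul (a := ‖c‖ₑ) (μ.tendsto_lintegral_nhdsL1 g)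
      (.inr enorm_ne_top)
    simpa [← mul_sub, enorm_mul, lintegral_const_mul' _ _ enorm_ne_top] using hlim
  · simp only [map_smul, smul_eq_mul]
    exact hI.2.const_mul c

theorem HasIntegral.sub {g k : X → ℂ} {I J : ℂ} (hI : μ.HasIntegral g I)
    (hJ : μ.HasIntegral k J) : μ.HasIntegral (g - k) (I - J) := by
  convert hI.add (hJ.const_mul (-1)) using 1
  · ext x
    simp [sub_eq_add_neg]
  · ring

end Integral

section Translate

variable {G : Type*} [AddCommGroup G] [TopologicalSpace G] [IsTopologicalAddGroup G]

theorem variationFun_translate (t : G) (μ : RadonMeasure G) (φ : C_c(G, ℝ≥0)) :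
    (translate t μ).variationFun φ =
      μ.variationFun (φ.comp (Homeomorph.addRight t).toCocompactMap) := by
  apply le_antisymm
  · refine variationFun_le _ fun ψ hψ => ?_
    rw [translate_apply]
    refine μ.nnnorm_le_variationFun fun x => ?_
    simpa [translateFun_apply] using hψ (x + t)
  · refine variationFun_le _ fun ψ hψ => ?_
    have hμψ : μ ψ = translate t μ (translateFun t ψ) := by
      rw [translate_apply]
      congr 1
      ext x
      simp [translateFun_apply]
    rw [hμψ]
    refine nnnorm_le_variationFun _ fun x => ?_
    simpa [translateFun_apply] using hψ (x - t)

variable [T2Space G] [LocallyCompactSpace G]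

theorem totalVariation_translate (t : G) (μ : RadonMeasure G) :
    (translate t μ).totalVariation =
      @Measure.map G G (borel G) (borel G) (· + t) μ.totalVariation := by
  borelize G
  have := μ.regular_totalVariation
  have := (translate t μ).regular_totalVariation
  have : (μ.totalVariation.map (· + t)).Regular := Measure.Regular.map (Homeomorph.addRight t)
  refine Measure.ext_of_integral_eq_on_compactlySupported_nnreal fun φ => ?_
  calc ∫ x, (φ x : ℝ) ∂(translate t μ).totalVariation = (translate t μ).variationFun φ :=
        NNRealRMK.integral_rieszMeasure _ φ
    _ = μ.variationFun (φ.comp (Homeomorph.addRight t).toCocompactMap) := by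
        rw [variationFun_translate]
    _ = ∫ x, (φ (x + t) : ℝ) ∂μ.totalVariation :=
        (NNRealRMK.integral_rieszMeasure μ.variation _).symm
    _ = ∫ x, (φ x : ℝ) ∂μ.totalVariation.map (· + t) :=
        ((Homeomorph.addRight t).measurableEmbedding.integral_map fun x => (φ x : ℝ)).symm

theorem lintegral_totalVariation_translate (t : G) (μ : RadonMeasure G) (F : G → ℝ≥0∞) :
    ∫⁻ x, F x ∂(translate t μ).totalVariation = ∫⁻ x, F (x + t) ∂μ.totalVariation := by
  borelize G
  rw [totalVariation_translate]
  exact (Homeomorph.addRight t).measurableEmbedding.lintegral_map F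

theorem totalVariation_translate_apply (t : G) (μ : RadonMeasure G) (B : Set G) :
    (translate t μ).totalVariation B = μ.totalVariation ((· + t) ⁻¹' B) := by
  borelize G
  rw [totalVariation_translate]
  exact (Homeomorph.addRight t).measurableEmbedding.map_apply _ B

theorem HasIntegral.comp_add_right {t : G} {μ : RadonMeasure G} {g : G → ℂ} {I : ℂ}
    (h : (translate t μ).HasIntegral g I) : μ.HasIntegral (fun x => g (x + t)) I := by
  borelize G
  have := nhdsL1_neBot h.1
  refine hasIntegral_of_tendsto (l := (translate t μ).nhdsL1 g) (ψ := translateFun (-t)) ?_ ?_ h.2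
  · have hint := h.1
    rw [totalVariation_translate] at hint
    exact ((Homeomorph.addRight t).measurableEmbedding.integrable_map_iff).1 hint
  · simpa [lintegral_totalVariation_translate, translateFun_apply] using
      (translate t μ).tendsto_lintegral_nhdsL1 g

end Translate

end RadonMeasure

theorem lintegral_tsum_indicator_le {X ι : Type*} [MeasurableSpace X] {μ : Measure X}
    {s : ι → Set X} (hs : ∀ i, MeasurableSet (s i)) {C : ℝ≥0∞} (hμ : ∀ i, μ (s i) ≤ C)
    {a : ι → ℝ≥0∞} (ha : ∑' i, a i ≠ ∞) :
    ∫⁻ x, ∑' i, (s i).indicator (fun _ => a i) x ∂μ ≤ C * ∑' i, a i := by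
  have : Countable (support a) := (Summable.countable_support_ennreal ha).to_subtype
  have hsupp (x : X) : ∑' i : support a, (s i).indicator (fun _ => a i) x =
      ∑' i, (s i).indicator (fun _ => a i) x :=
    tsum_subtype_eq_of_support_subset (f := fun i => (s i).indicator (fun _ => a i) x)
      fun i hi (hai : a i = 0) => hi (by simp [hai])
  calc ∫⁻ x, ∑' i, (s i).indicator (fun _ => a i) x ∂μ
      = ∫⁻ x, ∑' i : support a, (s i).indicator (fun _ => a i) x ∂μ := by simp only [hsupp]
    _ = ∑' i : support a, ∫⁻ x, (s i).indicator (fun _ => a i) x ∂μ :=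
        lintegral_tsum fun i => (measurable_const.indicator (hs i)).aemeasurable
    _ = ∑' i : support a, a i * μ (s i) :=
        tsum_congr fun i => lintegral_indicator_const (hs i) _
    _ ≤ ∑' i, a i * μ (s i) := ENNReal.tsum_comp_le_tsum_of_injective Subtype.val_injective _
    _ ≤ ∑' i, a i * C := ENNReal.tsum_le_tsum fun i => mul_le_mul_right (hμ i) _
    _ = C * ∑' i, a i := by rw [ENNReal.tsum_mul_right, mul_comm]

section Cocompact

variable {X : Type*} [AddCommGroup X] [TopologicalSpace X] [IsTopologicalAddGroup X]
  [LocallyCompactSpace X]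

theorem exists_isCompact_add_mem (L : AddSubgroup X) [CompactSpace (X ⧸ L)] :
    ∃ K : Set X, IsCompact K ∧ ∀ x, ∃ l ∈ L, ∃ k ∈ K, x = l + k := by
  choose C hC hCnhds using fun x : X => exists_compact_mem_nhds x
  obtain ⟨t, -, ht⟩ := (isCompact_univ (X := X ⧸ L)).elim_nhds_subcover
    (fun q => ((↑) : X → X ⧸ L) '' C q.out) fun q _ => by
      simpa using (QuotientAddGroup.isOpenMap_coe (N := L)).image_mem_nhds (hCnhds q.out)
  refine ⟨⋃ q ∈ t, C q.out, t.isCompact_biUnion fun q _ => hC _, fun x => ?_⟩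
  obtain ⟨q, hq, k, hk, hkx⟩ := mem_iUnion₂.1 (ht (mem_univ (x : X ⧸ L)))
  exact ⟨-k + x, QuotientAddGroup.eq.1 hkx, k, mem_biUnion hq hk, by abel⟩

theorem IsPeriodic.exists_totalVariation_preimage_sub_le [T2Space X] {L : AddSubgroup X}
    [CompactSpace (X ⧸ L)] {μ : RadonMeasure X} (hμ : IsPeriodic L μ) {Q : Set X}
    (hQ : IsCompact Q) :
    ∃ C : ℝ≥0, ∀ z, μ.totalVariation ((· - z) ⁻¹' Q) ≤ C := by
  obtain ⟨K, hK, hKL⟩ := exists_isCompact_add_mem L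
  refine ⟨(μ.totalVariation (Q + K)).toNNReal, fun z => ?_⟩
  rw [ENNReal.coe_toNNReal (μ.totalVariation_lt_top_of_isCompact (hQ.add hK)).ne]
  obtain ⟨l, hl, k, hk, rfl⟩ := hKL z
  calc μ.totalVariation ((· - (l + k)) ⁻¹' Q)
      = (translate l μ).totalVariation ((· - (l + k)) ⁻¹' Q) := by rw [hμ l hl]
    _ = μ.totalVariation ((· + l) ⁻¹' ((· - (l + k)) ⁻¹' Q)) :=
        μ.totalVariation_translate_apply l _
    _ ≤ μ.totalVariation (Q + K) := measure_mono fun y hy =>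
        ⟨y - k, by simpa [add_sub_add_right_eq_sub, add_comm l] using hy, k, hk, sub_add_cancel y k⟩

end Cocompact

/-- The convolution of the weights `a` with the indicator function of `Q`. Weights on a discrete
subset of `H` are extended by zero, so that the sum runs over all points of `H`. -/
noncomputable def translateSum {H : Type*} [AddCommGroup H] (Q : Set H) (a : H → ℝ≥0∞) (y : H) :
    ℝ≥0∞ :=
  ∑' z, Q.indicator (fun _ => a z) (y - z)

/-- The Wiener amalgam space `W(C, ℓ¹)`: continuous functions that are dominated by a summable
superposition of indicator functions of translates of a single compact set. -/
structure MemWienerAmalgam {H : Type*} [AddCommGroup H] [TopologicalSpace H] (h : H → ℂ) :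
    Prop where
  continuous : Continuous h
  exists_le_translateSum : ∃ Q : Set H, IsCompact Q ∧ ∃ a : H → ℝ≥0∞,
    ∑' z, a z ≠ ∞ ∧ ∀ y, ‖h y‖ₑ ≤ translateSum Q a y

section Projection

variable {G H : Type*} [TopologicalSpace G] [TopologicalSpace H]
  [T2Space G] [LocallyCompactSpace G] [T2Space H] [LocallyCompactSpace H]
  {ρ : RadonMeasure (G × H)} {h : H → ℂ} {μ ν : RadonMeasure G}

theorem IsProjectedMeasure.unique (hμ : IsProjectedMeasure ρ h μ)
    (hν : IsProjectedMeasure ρ h ν) : μ = ν :=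
  Subtype.ext <| LinearMap.ext fun φ => (hμ φ).unique (hν φ)

variable [AddCommGroup G] [IsTopologicalAddGroup G] [AddCommGroup H] [IsTopologicalAddGroup H]
  {L : AddSubgroup (G × H)}

theorem IsPeriodic.exists_lintegral_enorm_mul_le [CompactSpace ((G × H) ⧸ L)]
    (hρ : IsPeriodic L ρ) {K : Set G} (hK : IsCompact K) {Q : Set H} (hQ : IsCompact Q) :
    ∃ C : ℝ≥0, ∀ (x : G) (φ : G → ℂ) (M : ℝ≥0) (h : H → ℂ) (a : H → ℝ≥0∞),
      (∀ u, φ u ≠ 0 → u - x ∈ K) → (∀ u, ‖φ u‖ₑ ≤ M) →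
      ∑' z, a z ≠ ∞ → (∀ y, ‖h y‖ₑ ≤ translateSum Q a y) →
      ∫⁻ p, ‖φ p.1 * h p.2‖ₑ ∂ρ.totalVariation ≤ C * (M * ∑' z, a z) := by
  borelize (G × H)
  obtain ⟨C, hC⟩ := hρ.exists_totalVariation_preimage_sub_le (hK.prod hQ)
  refine ⟨C, fun x φ M h a hφK hφM ha hha => ?_⟩
  let s (z : H) : Set (G × H) := (· - (x, z)) ⁻¹' (K ×ˢ Q)
  have hs (z : H) : MeasurableSet (s z) :=
    ((hK.prod hQ).isClosed.preimage (continuous_sub_right _)).measurableSet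
  have hpointwise (p : G × H) :
      ‖φ p.1 * h p.2‖ₑ ≤ ∑' z, (s z).indicator (fun _ => M * a z) p := by
    obtain hp | hp := eq_or_ne (φ p.1) 0
    · simp [hp]
    calc ‖φ p.1 * h p.2‖ₑ ≤ M * translateSum Q a p.2 := by
          rw [enorm_mul]
          exact mul_le_mul' (hφM _) (hha _)
      _ = ∑' z, (s z).indicator (fun _ => M * a z) p := by
          rw [translateSum, ← ENNReal.tsum_mul_left]
          refine tsum_congr fun z => ?_
          by_cases hz : p.2 - z ∈ Q <;> simp [s, indicator, hφK _ hp, hz]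
  calc ∫⁻ p, ‖φ p.1 * h p.2‖ₑ ∂ρ.totalVariation
      ≤ ∫⁻ p, ∑' z, (s z).indicator (fun _ => M * a z) p ∂ρ.totalVariation :=
        lintegral_mono hpointwise
    _ ≤ C * ∑' z, M * a z := lintegral_tsum_indicator_le hs (fun z => hC (x, z)) <| by
        rw [ENNReal.tsum_mul_left]
        exact ENNReal.mul_ne_top ENNReal.coe_ne_top ha
    _ = C * (M * ∑' z, a z) := by rw [ENNReal.tsum_mul_left]

theorem IsPeriodic.exists_lintegral_enorm_mul_le_iSup_norm [CompactSpace ((G × H) ⧸ L)]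
    (hρ : IsPeriodic L ρ) (hh : MemWienerAmalgam h) {K : Set G} (hK : IsCompact K) :
    ∃ C : ℝ≥0, ∀ φ : C_c(G, ℂ), tsupport φ ⊆ K →
      ∫⁻ p, ‖φ p.1 * h p.2‖ₑ ∂ρ.totalVariation ≤ ENNReal.ofReal (C * ⨆ x, ‖φ x‖) := by
  obtain ⟨Q, hQ, a, ha, hha⟩ := hh.exists_le_translateSum
  obtain ⟨C, hC⟩ := hρ.exists_lintegral_enorm_mul_le hK hQ
  refine ⟨C * (∑' z, a z).toNNReal, fun φ hφ => ?_⟩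
  obtain ⟨B, hB⟩ := φ.hasCompactSupport.exists_bound_of_continuous φ.continuous
  have hφ_supp (u : G) (hu : φ u ≠ 0) : u - 0 ∈ K := by
    rw [sub_zero]
    exact hφ (subset_tsupport φ hu)
  have hφ_le (u : G) : ‖φ u‖ₑ ≤ (⨆ x, ‖φ x‖).toNNReal := by
    rw [← ofReal_norm]
    exact ENNReal.ofReal_le_ofReal (le_ciSup (f := fun x => ‖φ x‖) ⟨B, forall_mem_range.2 hB⟩ u)
  calc ∫⁻ p, ‖φ p.1 * h p.2‖ₑ ∂ρ.totalVariation
      ≤ C * (ENNReal.ofReal (⨆ x, ‖φ x‖) * ∑' z, a z) := hC 0 φ _ h a hφ_supp hφ_le ha hha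
    _ = ENNReal.ofReal ((C * (∑' z, a z).toNNReal : ℝ≥0) * ⨆ x, ‖φ x‖) := by
        rw [ENNReal.ofReal_mul (by positivity), ENNReal.ofReal_coe_nnreal, ENNReal.coe_mul,
          ENNReal.coe_toNNReal ha, mul_assoc, mul_comm (∑' z, a z)]

theorem IsPeriodic.exists_isProjectedMeasure [CompactSpace ((G × H) ⧸ L)] (hρ : IsPeriodic L ρ)
    (hh : MemWienerAmalgam h) : ∃ μ, IsProjectedMeasure ρ h μ := by
  have hint (φ : C_c(G, ℂ)) : Integrable (fun p : G × H => φ p.1 * h p.2) ρ.totalVariation := by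
    obtain ⟨C, hC⟩ := hρ.exists_lintegral_enorm_mul_le_iSup_norm hh φ.hasCompactSupport
    exact ⟨ρ.aestronglyMeasurable_of_continuous
      ((φ.continuous.comp continuous_fst).mul (hh.continuous.comp continuous_snd)),
      (hC φ subset_rfl).trans_lt ENNReal.ofReal_lt_top⟩
  choose I hI using fun φ => RadonMeasure.exists_hasIntegral (hint φ)
  refine ⟨⟨{ toFun := I, map_add' := fun φ θ => ?_, map_smul' := fun c φ => ?_ },
    fun K hK => ?_⟩, hI⟩
  · refine (hI (φ + θ)).unique ?_
    convert (hI φ).add (hI θ) using 1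
    ext p
    simp [add_mul]
  · refine (hI (c • φ)).unique ?_
    simpa [mul_assoc] using (hI φ).const_mul c
  · obtain ⟨C, hC⟩ := hρ.exists_lintegral_enorm_mul_le_iSup_norm hh hK
    refine ⟨C, fun φ hφ => ?_⟩
    have hIφ := (hI φ).enorm_le.trans (hC φ hφ)
    rw [← ofReal_norm] at hIφ
    exact (ENNReal.ofReal_le_ofReal_iff
      (mul_nonneg C.2 (Real.iSup_nonneg fun _ => norm_nonneg _))).1 hIφ

theorem IsProjectedMeasure.translate_sub (hρ : IsPeriodic L ρ) (hμ : IsProjectedMeasure ρ h μ)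
    {s : G} {w : H} (hsw : (s, w) ∈ L) :
    IsProjectedMeasure ρ (fun y => h (y - w) - h y) (translate s μ - μ) := by
  intro φ
  have hμs : (translate (-(s, w)) ρ).HasIntegral
      (fun p => translateFun (-s) φ p.1 * h p.2) (translate s μ φ) := by
    rw [hρ _ (neg_mem hsw)]
    exact hμ (translateFun (-s) φ)
  convert hμs.comp_add_right.sub (hμ φ) using 1
  · ext p
    simp [translateFun_apply, mul_sub, ← sub_eq_add_neg]
  · rfl

theorem exists_cutoff {X : Type*} [TopologicalSpace X] [T2Space X] [LocallyCompactSpace X]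
    {K : Set X} (hK : IsCompact K) : ∃ χ : C_c(X, ℝ≥0), (∀ x ∈ K, χ x = 1) ∧ ∀ x, χ x ≤ 1 := by
  obtain ⟨χ, hχ1, -, hχsupp, hχI⟩ := exists_continuous_one_zero_of_isCompact hK isClosed_empty
    (disjoint_empty K)
  exact ⟨⟨⟨fun x => (χ x).toNNReal, by fun_prop⟩, hχsupp.comp_left Real.toNNReal_zero⟩,
    fun x hx => by simpa using congrArg Real.toNNReal (hχ1 hx), fun x => by simpa using (hχI x).2⟩

theorem IsPeriodic.exists_aNorm_le [CompactSpace ((G × H) ⧸ L)] (hρ : IsPeriodic L ρ)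
    {Q : Set H} (hQ : IsCompact Q) {A : Set G} (hA : IsCompact (closure A)) :
    ∃ C : ℝ≥0, ∀ (h : H → ℂ) (a : H → ℝ≥0∞) (μ : RadonMeasure G), IsProjectedMeasure ρ h μ →
      ∑' z, a z ≠ ∞ → (∀ y, ‖h y‖ₑ ≤ translateSum Q a y) → aNorm A μ ≤ C * ∑' z, a z := by
  obtain ⟨χ, hχA, hχ1⟩ := exists_cutoff hA
  obtain ⟨C, hC⟩ := hρ.exists_lintegral_enorm_mul_le χ.hasCompactSupport.isCompact hQ
  refine ⟨C, fun h a μ hμ ha hha => iSup_le fun x => ?_⟩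
  let χx : C_c(G, ℝ≥0) := χ.comp (Homeomorph.subRight x).toCocompactMap
  have hχx (u : G) : χx u = χ (u - x) := rfl
  refine RadonMeasure.totalVariation_le_of_forall_enorm_le (χ := χx) ?_ fun ψ hψ => ?_
  · rintro _ ⟨y, hy, rfl⟩
    simp [hχx, hχA y (subset_closure hy)]
  · have hψsupp (u : G) (hu : ψ u ≠ 0) : u - x ∈ tsupport χ :=
      subset_tsupport χ fun h0 => hu (by simpa [hχx, h0] using hψ u)
    have hψ1 (u : G) : ‖ψ u‖ₑ ≤ (1 : ℝ≥0) := ENNReal.coe_le_coe.2 ((hψ u).trans (hχ1 _))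
    simpa using (hμ ψ).enorm_le.trans (hC x ψ 1 h a hψsupp hψ1 ha hha)

end Projection

section TSum

variable {ι : Type*} {a : ι → ℝ≥0∞}

theorem tendsto_tsum_zero_of_le {α : Type*} {l : Filter α} {f : α → ι → ℝ≥0∞}
    (ha : ∑' i, a i ≠ ∞) (hfa : ∀ x i, f x i ≤ a i) (hf : ∀ i, Tendsto (f · i) l (𝓝 0)) :
    Tendsto (fun x => ∑' i, f x i) l (𝓝 0) := by
  refine ENNReal.tendsto_nhds_zero.2 fun ε hε => ?_
  obtain ⟨s, hs⟩ := (ENNReal.tendsto_nhds_zero.1 (ENNReal.tendsto_tsum_compl_atTop_zero ha) (ε / 2)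
    (ENNReal.half_pos hε.ne')).exists
  have hsum : Tendsto (fun x => ∑ i ∈ s, f x i) l (𝓝 0) := by
    simpa using tendsto_finsetSum s fun i _ => hf i
  filter_upwards [ENNReal.tendsto_nhds_zero.1 hsum (ε / 2) (ENNReal.half_pos hε.ne')] with x hx
  calc ∑' i, f x i = ∑ i ∈ s, f x i + ∑' i : ↥(s : Set ι)ᶜ, f x i :=
        (ENNReal.sum_add_tsum_compl s (f x)).symm
    _ ≤ ε / 2 + ε / 2 := add_le_add hx <| le_trans (ENNReal.tsum_le_tsum fun i => hfa x i) hs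
    _ = ε := ENNReal.add_halves ε

theorem tendsto_tsum_min_zero (ha : ∑' i, a i ≠ ∞) :
    Tendsto (fun δ => ∑' i, min δ (a i)) (𝓝 0) (𝓝 0) := by
  refine tendsto_tsum_zero_of_le ha (fun δ i => min_le_right _ _) fun i => ?_
  simpa using (continuous_id.min (continuous_const (y := a i))).tendsto (0 : ℝ≥0∞)

theorem min_tsum_le_tsum_min (δ : ℝ≥0∞) : min δ (∑' i, a i) ≤ ∑' i, min δ (a i) := by
  by_cases h : ∃ i, δ ≤ a i
  · obtain ⟨i, hi⟩ := h
    calc min δ (∑' i, a i) ≤ min δ (a i) := (min_le_left _ _).trans (le_min le_rfl hi)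
      _ ≤ ∑' i, min δ (a i) := ENNReal.le_tsum i
  · push Not at h
    exact (min_le_right _ _).trans (ENNReal.tsum_le_tsum fun i => le_min (h i).le le_rfl)

end TSum

section TranslateSum

variable {H : Type*} [AddCommGroup H] {Q : Set H} {a : H → ℝ≥0∞}

theorem le_translateSum {y z : H} (hz : y - z ∈ Q) : a z ≤ translateSum Q a y :=
  calc a z = Q.indicator (fun _ => a z) (y - z) := (indicator_of_mem hz fun _ => a z).symm
    _ ≤ translateSum Q a y := ENNReal.le_tsum (f := fun z => Q.indicator (fun _ => a z) (y - z)) z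

theorem translateSum_sub_le {V : Set H} {w : H} (hw : w ∈ V) (y : H) :
    translateSum Q a (y - w) ≤ translateSum (Q + V) a y :=
  ENNReal.tsum_le_tsum fun z => by
    by_cases hz : y - w - z ∈ Q
    · have hzV : y - z ∈ Q + V := by
        rw [show y - z = y - w - z + w by abel]
        exact add_mem_add hz hw
      rw [indicator_of_mem hz, indicator_of_mem hzV]
    · rw [indicator_of_notMem hz]
      exact zero_le

theorem translateSum_add_weights (b : H → ℝ≥0∞) (y : H) :
    translateSum Q (a + b) y = translateSum Q a y + translateSum Q b y := by
  rw [translateSum, translateSum, translateSum, ← ENNReal.tsum_add]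
  refine tsum_congr fun z => ?_
  by_cases hz : y - z ∈ Q <;> simp [hz]

theorem min_translateSum_le (δ : ℝ≥0∞) (y : H) :
    min δ (translateSum Q a y) ≤ translateSum Q (fun z => min δ (a z)) y := by
  refine (min_tsum_le_tsum_min δ).trans (ENNReal.tsum_le_tsum fun z => ?_)
  by_cases hz : y - z ∈ Q <;> simp [hz]

theorem tendsto_translateSum_cocompact [TopologicalSpace H] [IsTopologicalAddGroup H]
    (hQ : IsCompact Q) (ha : ∑' z, a z ≠ ∞) :
    Tendsto (translateSum Q a) (cocompact H) (𝓝 0) := by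
  refine tendsto_tsum_zero_of_le ha (fun y z => indicator_le_self' (fun _ _ => zero_le) _)
    fun z => ?_
  have hz : (· - z) ⁻¹' Qᶜ ∈ cocompact H :=
    (Homeomorph.subRight z).isClosedEmbedding.tendsto_cocompact hQ.compl_mem_cocompact
  refine tendsto_const_nhds.congr' ?_
  filter_upwards [hz] with y hy
  exact (indicator_of_notMem hy _).symm

end TranslateSum

namespace MemWienerAmalgam

variable {H : Type*} [AddCommGroup H] [TopologicalSpace H] [IsTopologicalAddGroup H] {h : H → ℂ}

theorem tendsto_cocompact (hh : MemWienerAmalgam h) : Tendsto h (cocompact H) (𝓝 0) := by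
  obtain ⟨Q, hQ, a, ha, hha⟩ := hh.exists_le_translateSum
  exact tendsto_zero_iff_enorm_tendsto_zero.2 <| tendsto_of_tendsto_of_tendsto_of_le_of_le
    tendsto_const_nhds (tendsto_translateSum_cocompact hQ ha) (fun _ => zero_le) hha

theorem eventually_enorm_translate_sub_le (hh : MemWienerAmalgam h) {δ : ℝ≥0∞} (hδ : 0 < δ) :
    ∀ᶠ w in 𝓝 0, ∀ y, ‖h (y - w) - h y‖ₑ ≤ δ := by
  let _ := IsTopologicalAddGroup.rightUniformSpace H
  have : IsUniformAddGroup H := isUniformAddGroup_of_addCommGroup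
  have hunif : UniformContinuous h :=
    hh.continuous.uniformContinuous_of_tendsto_cocompact hh.tendsto_cocompact
  have hδ_mem := hunif (edist_mem_uniformity hδ)
  rw [mem_map, uniformity_eq_comap_nhds_zero H, mem_comap] at hδ_mem
  obtain ⟨t, ht, htδ⟩ := hδ_mem
  filter_upwards [ht] with w hw y
  rw [← edist_eq_enorm_sub]
  have hwt : (y - w, y) ∈ (fun p : H × H => p.2 - p.1) ⁻¹' t := by simpa using hw
  exact (htδ hwt).le

-- A difference is bounded by `δ` and by a fixed translate sum, hence by the translate sum whose
-- weights are truncated at `δ`.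
theorem exists_translate_sub_le_translateSum [LocallyCompactSpace H] (hh : MemWienerAmalgam h) :
    ∃ Q : Set H, IsCompact Q ∧ ∀ ε : ℝ≥0∞, 0 < ε → ∀ᶠ w in 𝓝 0, ∃ a : H → ℝ≥0∞,
      ∑' z, a z ≤ ε ∧ ∀ y, ‖h (y - w) - h y‖ₑ ≤ translateSum Q a y := by
  obtain ⟨Q, hQ, a, ha, hha⟩ := hh.exists_le_translateSum
  obtain ⟨V, hV, hV0⟩ := exists_compact_mem_nhds (0 : H)
  refine ⟨Q + V, hQ.add hV, fun ε hε => ?_⟩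
  have haa : ∑' z, (a + a) z ≠ ∞ := by
    simp only [Pi.add_apply, ENNReal.tsum_add]
    exact ENNReal.add_ne_top.2 ⟨ha, ha⟩
  obtain ⟨δ, hδ, hδε⟩ := ENNReal.nhds_zero_basis_Iic.mem_iff.1
    (ENNReal.tendsto_nhds_zero.1 (tendsto_tsum_min_zero haa) ε hε)
  filter_upwards [hV0, hh.eventually_enorm_translate_sub_le hδ] with w hw hwδ
  refine ⟨fun z => min δ ((a + a) z), hδε self_mem_Iic, fun y => ?_⟩
  have hbound (v : H) (hv : v ∈ V) : ‖h (y - v)‖ₑ ≤ translateSum (Q + V) a y :=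
    (hha _).trans (translateSum_sub_le hv y)
  have hsum : ‖h (y - w) - h y‖ₑ ≤ translateSum (Q + V) (a + a) y :=
    calc ‖h (y - w) - h y‖ₑ ≤ ‖h (y - w)‖ₑ + ‖h (y - 0)‖ₑ := by
          rw [sub_zero]
          exact enorm_sub_le
      _ ≤ translateSum (Q + V) a y + translateSum (Q + V) a y :=
          add_le_add (hbound w hw) (hbound 0 (mem_of_mem_nhds hV0))
      _ = translateSum (Q + V) (a + a) y := (translateSum_add_weights a y).symm
  exact (le_min (hwδ y) hsum).trans (min_translateSum_le δ y)

end MemWienerAmalgam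

theorem IsRelativelyDense.mono {G : Type*} [AddCommGroup G] [TopologicalSpace G] {P P' : Set G}
    (hP : IsRelativelyDense P) (h : P ⊆ P') : IsRelativelyDense P' := by
  obtain ⟨K, hK, hKP⟩ := hP
  refine ⟨K, hK, fun x => ?_⟩
  obtain ⟨p, hp, hx⟩ := hKP x
  exact ⟨p, h hp, hx⟩

section AlmostPeriodic

variable {G H : Type*} [AddCommGroup G] [TopologicalSpace G] [IsTopologicalAddGroup G]
  [AddCommGroup H] [TopologicalSpace H] [IsTopologicalAddGroup H]
  [LocallyCompactSpace G] [LocallyCompactSpace H]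

theorem isRelativelyDense_fst_of_snd_mem (L : AddSubgroup (G × H)) [CompactSpace ((G × H) ⧸ L)]
    {U : Set H} (hU : U ∈ 𝓝 0) : IsRelativelyDense {s : G | ∃ w ∈ U, (s, w) ∈ L} := by
  obtain ⟨K, hK, hKL⟩ := exists_isCompact_add_mem L
  have hcompact : IsCompact (Prod.snd '' K ∩ closure (Prod.snd '' (L : Set (G × H)))) :=
    (hK.image continuous_snd).inter_right isClosed_closure
  obtain ⟨t, ht⟩ := hcompact.elim_finite_subcover
    (fun l : L => ((l : G × H).2 - ·) ⁻¹' interior U)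
    (fun l => isOpen_interior.preimage (continuous_sub_left _)) fun c hc => by
      obtain ⟨_, hw, l, hl, rfl⟩ := mem_closure_iff_nhds.1 hc.2 ((· - c) ⁻¹' interior U)
        ((continuous_sub_right c).continuousAt.preimage_mem_nhds (by simpa using hU))
      exact mem_iUnion.2 ⟨⟨l, hl⟩, hw⟩
  refine ⟨⋃ l ∈ t, (fun k : G × H => k.1 - (l : G × H).1) '' K,
    t.isCompact_biUnion fun l _ => hK.image (by fun_prop), fun x => ?_⟩
  obtain ⟨m, hm, k, hk, hx⟩ := hKL (x, 0)
  obtain ⟨hx1, hx2⟩ : x = m.1 + k.1 ∧ 0 = m.2 + k.2 := Prod.ext_iff.1 hx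
  have hk2 : k.2 = (-m).2 := eq_neg_of_add_eq_zero_right hx2.symm
  obtain ⟨l, hl, hlk⟩ := mem_iUnion₂.1
    (ht ⟨mem_image_of_mem _ hk, subset_closure ⟨-m, neg_mem hm, hk2.symm⟩⟩)
  refine ⟨m.1 + (l : G × H).1, ⟨m.2 + (l : G × H).2, ?_, add_mem hm l.2⟩, k.1 - (l : G × H).1,
    mem_biUnion hl (mem_image_of_mem _ hk), by rw [hx1]; abel⟩
  rw [mem_preimage, hk2, Prod.snd_neg, sub_neg_eq_add, add_comm] at hlk
  exact interior_subset hlk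

variable [T2Space G] [T2Space H] {L : AddSubgroup (G × H)} [CompactSpace ((G × H) ⧸ L)]
  {ρ : RadonMeasure (G × H)} {h : H → ℂ} {μ : RadonMeasure G}

theorem IsProjectedMeasure.isNormAlmostPeriodic (hρ : IsPeriodic L ρ) (hh : MemWienerAmalgam h)
    (hμ : IsProjectedMeasure ρ h μ) {A : Set G} (hA : IsCompact (closure A)) :
    IsNormAlmostPeriodic A μ := by
  constructor
  · obtain ⟨Q, hQ, a, ha, hha⟩ := hh.exists_le_translateSum
    obtain ⟨C, hC⟩ := hρ.exists_aNorm_le hQ hA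
    exact (hC h a μ hμ ha hha).trans_lt (ENNReal.mul_lt_top ENNReal.coe_lt_top ha.lt_top)
  · intro ε hε
    obtain ⟨Q, hQ, hsub⟩ := hh.exists_translate_sub_le_translateSum
    obtain ⟨C, hC⟩ := hρ.exists_aNorm_le hQ hA
    obtain ⟨η, hη, hηε⟩ := ENNReal.exists_nnreal_pos_mul_lt (ENNReal.coe_ne_top (r := C))
      (ENNReal.ofReal_pos.2 hε).ne'
    refine (isRelativelyDense_fst_of_snd_mem L (hsub η (by exact_mod_cast hη))).mono ?_
    rintro s ⟨w, ⟨a, ha, hwa⟩, hsw⟩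
    calc aNorm A (translate s μ - μ)
        ≤ C * ∑' z, a z :=
          hC _ a _ (hμ.translate_sub hρ hsw) (ha.trans_lt ENNReal.coe_lt_top).ne hwa
      _ ≤ η * C := by
          rw [mul_comm]
          exact mul_le_mul_left ha _
      _ < ENNReal.ofReal ε := hηε

end AlmostPeriodic

namespace MemWienerAmalgam

theorem of_hasCompactSupport {H : Type*} [AddCommGroup H] [TopologicalSpace H] {f : H → ℂ}
    (hf : Continuous f) (hfs : HasCompactSupport f) : MemWienerAmalgam f := by
  classical
  obtain ⟨C, hC⟩ := hfs.exists_bound_of_continuous hf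
  let a : H → ℝ≥0∞ := Pi.single 0 (ENNReal.ofReal C)
  refine ⟨hf, tsupport f, hfs, a, ?_, fun y => ?_⟩
  · rw [tsum_pi_single]
    exact ENNReal.ofReal_ne_top
  · obtain hy | hy := eq_or_ne (f y) 0
    · simp [hy]
    · calc ‖f y‖ₑ ≤ ENNReal.ofReal C := by
            rw [← ofReal_norm]
            exact ENNReal.ofReal_le_ofReal (hC y)
        _ = a 0 := by simp [a]
        _ ≤ translateSum (tsupport f) a y :=
            le_translateSum (by rw [sub_zero]; exact subset_tsupport f hy)

theorem mul_prod {E F : Type*} [AddCommGroup E] [TopologicalSpace E] [AddCommGroup F]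
    [TopologicalSpace F] {f : E → ℂ} {g : F → ℂ} (hf : MemWienerAmalgam f)
    (hg : MemWienerAmalgam g) : MemWienerAmalgam fun p : E × F => f p.1 * g p.2 := by
  obtain ⟨Q, hQ, a, ha, hfa⟩ := hf.exists_le_translateSum
  obtain ⟨R, hR, b, hb, hgb⟩ := hg.exists_le_translateSum
  refine ⟨(hf.continuous.comp continuous_fst).mul (hg.continuous.comp continuous_snd), Q ×ˢ R,
    hQ.prod hR, fun z => a z.1 * b z.2, ?_, fun y => ?_⟩
  · simp only [ENNReal.tsum_prod', ENNReal.tsum_mul_left, ENNReal.tsum_mul_right]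
    exact ENNReal.mul_ne_top ha hb
  · calc ‖f y.1 * g y.2‖ₑ ≤ translateSum Q a y.1 * translateSum R b y.2 := by
          rw [enorm_mul]
          exact mul_le_mul' (hfa _) (hgb _)
      _ = translateSum (Q ×ˢ R) (fun z => a z.1 * b z.2) y := by
          rw [translateSum, translateSum, translateSum, ENNReal.tsum_prod',
            ← ENNReal.tsum_mul_right]
          refine tsum_congr fun u => ?_
          rw [← ENNReal.tsum_mul_left]
          refine tsum_congr fun v => ?_
          by_cases hu : y.1 - u ∈ Q <;> by_cases hv : y.2 - v ∈ R <;> simp [indicator, hu, hv]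

end MemWienerAmalgam

section Decay

theorem one_add_norm_le_mul {E : Type*} [SeminormedAddCommGroup E] {u l : E} {D : ℝ}
    (hD : ‖u - l‖ ≤ D) : 1 + ‖l‖ ≤ (1 + D) * (1 + ‖u‖) := by
  have hl : ‖l‖ ≤ ‖u‖ + ‖u - l‖ := norm_le_insert u l
  nlinarith [mul_nonneg ((norm_nonneg _).trans hD) (norm_nonneg u)]

variable {E : Type*} [NormedAddCommGroup E] [NormedSpace ℝ E] [FiniteDimensional ℝ E]

theorem summable_one_add_norm_pow_inv (L : Submodule ℤ E) [DiscreteTopology L] [IsZLattice ℝ L]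
    {n : ℕ} (hn : Module.finrank ℝ E < n) :
    Summable fun l : L => ((1 + ‖(l : E)‖) ^ n)⁻¹ := by
  refine .of_norm_bounded_eventually (ZLattice.summable_norm_pow_inv L n ?_) ?_
  · rwa [ZLattice.rank ℝ L]
  filter_upwards [(finite_singleton (0 : L)).compl_mem_cofinite] with l (hl : l ≠ 0)
  have hl0 : 0 < ‖l‖ := norm_pos_iff.2 hl
  rw [Real.norm_of_nonneg (by positivity), inv_pow]
  gcongr
  exact le_add_of_nonneg_left zero_le_one

-- Rounding `u` to the lattice point `l` changes `1 + ‖u‖` by at most a constant factor, so the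
-- weights `(1 + ‖l‖)⁻ⁿ` on the lattice dominate `f`.
theorem MemWienerAmalgam.of_decay {f : E → ℂ} (hf : Continuous f) {n : ℕ}
    (hn : Module.finrank ℝ E < n) {C : ℝ} (hC : ∀ u, (1 + ‖u‖) ^ n * ‖f u‖ ≤ C) :
    MemWienerAmalgam f := by
  let b := Module.finBasis ℝ E
  let L := Submodule.span ℤ (range b)
  let D : ℝ := ∑ i, ‖b i‖
  let a (l : L) : ℝ≥0∞ := ENNReal.ofReal ((1 + D) ^ n * C * ((1 + ‖(l : E)‖) ^ n)⁻¹)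
  have ha : ∑' l, a l ≠ ∞ :=
    ((summable_one_add_norm_pow_inv L hn).mul_left ((1 + D) ^ n * C)).tsum_ofReal_ne_top
  let a' : E → ℝ≥0∞ := Function.extend (↑) a 0
  refine ⟨hf, Metric.closedBall 0 D, isCompact_closedBall 0 D, a', ?_, fun u => ?_⟩
  · rwa [tsum_extend_zero Subtype.val_injective]
  let l : L := ZSpan.floor b u
  have hul : ‖u - l‖ ≤ D := ZSpan.norm_fract_le b u
  have hfu : ‖f u‖ ≤ (1 + D) ^ n * C * ((1 + ‖(l : E)‖) ^ n)⁻¹ := by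
    rw [← div_eq_mul_inv, le_div_iff₀ (by positivity)]
    calc ‖f u‖ * (1 + ‖(l : E)‖) ^ n ≤ ‖f u‖ * ((1 + D) * (1 + ‖u‖)) ^ n := by
          gcongr
          exact one_add_norm_le_mul hul
      _ = (1 + D) ^ n * ((1 + ‖u‖) ^ n * ‖f u‖) := by rw [mul_pow]; ring
      _ ≤ (1 + D) ^ n * C := by
          have : 0 ≤ D := (norm_nonneg _).trans hul
          gcongr
          exact hC u
  calc ‖f u‖ₑ ≤ a l := by
        rw [← ofReal_norm]
        exact ENNReal.ofReal_le_ofReal hfu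
    _ = a' l := (Subtype.val_injective.extend_apply _ _ l).symm
    _ ≤ translateSum (Metric.closedBall 0 D) a' u :=
        le_translateSum (mem_closedBall_zero_iff.2 hul)

end Decay

theorem IsStronglyAdmissible.memWienerAmalgam {d : ℕ} {H₀ : Type*} [AddCommGroup H₀]
    [TopologicalSpace H₀] {h : EuclideanSpace ℝ (Fin d) × H₀ → ℂ} (hh : IsStronglyAdmissible h) :
    MemWienerAmalgam h := by
  obtain ⟨f, φ, hf, -, ⟨C, hC⟩, hfφ⟩ := hh
  have hf_mem : MemWienerAmalgam f := by
    obtain rfl | hd := d.eq_zero_or_pos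
    · exact .of_hasCompactSupport hf.continuous (.of_compactSpace f)
    refine .of_decay hf.continuous (n := 2 * d) (C := 2 ^ (2 * d - 1) * C)
      (by rw [finrank_euclideanSpace_fin]; lia) fun u => ?_
    have hCu := hC u
    rw [norm_mul, Complex.norm_of_nonneg (by positivity)] at hCu
    calc (1 + ‖u‖) ^ (2 * d) * ‖f u‖
        ≤ 2 ^ (2 * d - 1) * (1 ^ (2 * d) + ‖u‖ ^ (2 * d)) * ‖f u‖ := by
          gcongr
          exact add_pow_le zero_le_one (norm_nonneg u) (2 * d)
      _ = 2 ^ (2 * d - 1) * ((1 + ‖u‖ ^ (2 * d)) * ‖f u‖) := by rw [one_pow, mul_assoc]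
      _ ≤ 2 ^ (2 * d - 1) * C := by gcongr
  rw [show h = fun p => f p.1 * φ p.2 from funext hfφ]
  exact hf_mem.mul_prod (.of_hasCompactSupport φ.continuous φ.hasCompactSupport)

end CutProject

theorem fact5p2_general {G H : Type*}
    [AddCommGroup G] [TopologicalSpace G] [IsTopologicalAddGroup G]
    [T2Space G] [LocallyCompactSpace G]
    [AddCommGroup H] [TopologicalSpace H] [IsTopologicalAddGroup H]
    [T2Space H] [LocallyCompactSpace H]
    (𝓛 : AddSubgroup (G × H)) [CompactSpace ((G × H) ⧸ 𝓛)]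
    (ρ : CutProject.RadonMeasure (G × H)) (hρ : CutProject.IsPeriodic 𝓛 ρ)
    (h : H → ℂ) (hh : CutProject.MemWienerAmalgam h) :
    (∃! μ : CutProject.RadonMeasure G, CutProject.IsProjectedMeasure ρ h μ) ∧
    ∀ μ : CutProject.RadonMeasure G, CutProject.IsProjectedMeasure ρ h μ →
      ∀ A : Set G, IsCompact (closure A) → CutProject.IsNormAlmostPeriodic A μ := by
  obtain ⟨μ, hμ⟩ := hρ.exists_isProjectedMeasure hh
  exact ⟨⟨μ, hμ, fun ν hν => hν.unique hμ⟩, fun ν hν A hA => hν.isNormAlmostPeriodic hρ hh hA⟩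

theorem fact5p2 {d : ℕ} {G H₀ : Type*}
    [AddCommGroup G] [TopologicalSpace G] [IsTopologicalAddGroup G]
    [T2Space G] [LocallyCompactSpace G]
    [AddCommGroup H₀] [TopologicalSpace H₀] [IsTopologicalAddGroup H₀]
    [T2Space H₀] [LocallyCompactSpace H₀]
    (𝓛 : AddSubgroup (G × (EuclideanSpace ℝ (Fin d) × H₀)))
    (h𝓛 : CutProject.IsCutAndProjectScheme 𝓛)
    (ρ : CutProject.RadonMeasure (G × (EuclideanSpace ℝ (Fin d) × H₀)))
    (hρ : CutProject.IsPeriodic 𝓛 ρ)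
    (h : EuclideanSpace ℝ (Fin d) × H₀ → ℂ)
    (hh : CutProject.IsStronglyAdmissible h) :
    (∃! μ : CutProject.RadonMeasure G, CutProject.IsProjectedMeasure ρ h μ) ∧
    ∀ μ : CutProject.RadonMeasure G, CutProject.IsProjectedMeasure ρ h μ →
      ∀ A : Set G, IsCompact (closure A) → (interior A).Nonempty →
        CutProject.IsNormAlmostPeriodic A μ := by
  have := h𝓛.cocompact
  obtain ⟨hex, hap⟩ := fact5p2_general 𝓛 ρ hρ h hh.memWienerAmalgam
  exact ⟨hex, fun μ hμ A hA _ => hap μ hμ A hA⟩
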